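/- Let $E$ be a (real) Banach lattice with norm dual $E'$. A net $(x_\alpha)$ in $E$ is \emph{order convergent} to $x$ if there is a net $(y_\beta)$, possibly over another index set, with $y_\beta\downarrow 0$ such that for every $\beta$ there is $\alpha_0$ with $|x_\alpha-x|\le y_\beta$ for all $\alpha\ge\alpha_0$. The net is \emph{$uo$-null} (respectively \emph{$un$-null}, \emph{$uaw$-null}) if for every $u\in E_+$ the net $(|x_\alpha|\wedge u)$ converges to $0$ in order (respectively in norm, weakly). It is \emph{disjoint} if $|x_\alpha|\wedge|x_\beta|=0$ whenever $\alpha\neq\beta$; disjoint nets are understood to be indexed by directed sets without a largest element. Let $f$ be an order continuous linear functional on $E$, that is, $f(x_\alpha)\to 0$ for every net $(x_\alpha)$ in $E$ that is order convergent to $0$. Then the following conditions are equivalent. \begin{enumerate} \item $f(x_\alpha)\to 0$ for every norm bounded $uo$-null net $(x_\alpha)$ in $E$. \item $f(x_n)\to 0$ for every norm bounded $uo$-null sequence $(x_n)$ in $E$. \item $f$ is norm bounded and $f(x_\alpha)\to 0$ for every norm bounded $uaw$-null net $(x_\alpha)$ in $E$. \item $f(x_n)\to 0$ for every norm bounded $uaw$-null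 sequence $(x_n)$ in $E$. \item $f$ is norm bounded and $f(x_\alpha)\to 0$ for every norm bounded disjoint net $(x_\alpha)$ in $E$. \item $f(x_n)\to 0$ for every norm bounded disjoint sequence $(x_n)$ in $E$. \item The modulus $|f|=f\vee(-f)$ exists, and every disjoint sequence in the order interval $[0,|f|]$ of $E'$ converges to $0$ in norm. \end{enumerate} If, in addition, $E$ has order continuous norm (that is, $\|x_\alpha\|\to 0$ for every net $x_\alpha\downarrow 0$ in $E$), then these conditions are also equivalent to each of the following. \begin{enumerate} \setcounter{enumi}{7} \item $f$ is norm bounded and $f(x_\alpha)\to 0$ for every norm bounded $un$-null net $(x_\alpha)$ in $E$. \item $f(x_n)\to 0$ for every norm bounded $un$-null sequence $(x_n)$ in $E$. \end{enumerate} -/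

import Mathlib

open Filter Topology

universe u v

section Convergence

variable {E : Type u} [NormedAddCommGroup E] [NormedSpace ℝ E] [Lattice E]

/-- The net `y` decreases to `0`: it is decreasing and its infimum is `0`. -/
def DecreasesToZero {B : Type v} [Preorder B] (y : B → E) : Prop :=
  Antitone y ∧ IsGLB (Set.range y) 0

/-- Order convergence of a net `x` to `l`; the dominating net `y` may be indexed by another
directed set.  Index sets in the universe of `E` suffice, since `y` may be replaced by the
inclusion of its range (with the reversed order). -/
def OrderConvergesTo {A : Type v} [Preorder A] (x : A → E) (l : E) : Prop :=
  ∃ (B : Type u) (_ : Preorder B) (_ : IsDirectedOrder B) (_ : Nonempty B) (y : B → E),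
    DecreasesToZero y ∧ ∀ b, ∃ a₀, ∀ a, a₀ ≤ a → |x a - l| ≤ y b

/-- Unbounded order convergence. -/
def UoConvergesTo {A : Type v} [Preorder A] (x : A → E) (l : E) : Prop :=
  ∀ w : E, 0 ≤ w → OrderConvergesTo (fun a => |x a - l| ⊓ w) 0

/-- Unbounded norm convergence. -/
def UnConvergesTo {A : Type v} [Preorder A] (x : A → E) (l : E) : Prop :=
  ∀ w : E, 0 ≤ w → Tendsto (fun a => ‖|x a - l| ⊓ w‖) atTop (𝓝 0)

/-- Unbounded absolute weak convergence: `|x a - l| ⊓ w → 0` weakly for every `w ≥ 0`. -/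
def UawConvergesTo {A : Type v} [Preorder A] (x : A → E) (l : E) : Prop :=
  ∀ w : E, 0 ≤ w → ∀ φ : StrongDual ℝ E, Tendsto (fun a => φ (|x a - l| ⊓ w)) atTop (𝓝 0)

/-- Pairwise disjointness of a family (in particular of a net or a sequence). -/
def IsDisjointFamily {A : Type v} (x : A → E) : Prop :=
  ∀ a b, a ≠ b → |x a| ⊓ |x b| = 0

/-- Norm boundedness of a family. -/
def IsNormBoundedFamily {A : Type v} (x : A → E) : Prop :=
  ∃ C : ℝ, ∀ a, ‖x a‖ ≤ C

variable (E) in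
/-- The norm of `E` is order continuous. -/
def HasOrderContinuousNorm : Prop :=
  ∀ (A : Type u) [Preorder A] [IsDirectedOrder A] [Nonempty A] (x : A → E),
    DecreasesToZero x → Tendsto (fun a => ‖x a‖) atTop (𝓝 0)

end Convergence

section Functionals

variable {E : Type u} [NormedAddCommGroup E] [NormedSpace ℝ E] [Lattice E]

/-- Order continuous linear functionals (the order continuous dual). -/
def IsOrderContinuousFunctional (f : E →ₗ[ℝ] ℝ) : Prop :=
  ∀ (A : Type u) [Preorder A] [IsDirectedOrder A] [Nonempty A] (x : A → E),
    OrderConvergesTo x 0 → Tendsto (fun a => f (x a)) atTop (𝓝 0)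

/-- Bounded uo-continuous linear functionals (the uo-dual). -/
def IsBoundedUoContinuous (f : E →ₗ[ℝ] ℝ) : Prop :=
  ∀ (A : Type u) [Preorder A] [IsDirectedOrder A] [Nonempty A] (x : A → E),
    IsNormBoundedFamily x → UoConvergesTo x 0 → Tendsto (fun a => f (x a)) atTop (𝓝 0)

/-- Bounded uaw-continuous functionals (the uaw-dual). -/
def IsBoundedUawContinuous (f : E →ₗ[ℝ] ℝ) : Prop :=
  Continuous f ∧
  ∀ (A : Type u) [Preorder A] [IsDirectedOrder A] [Nonempty A] (x : A → E),
    IsNormBoundedFamily x → UawConvergesTo x 0 → Tendsto (fun a => f (x a)) atTop (𝓝 0)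

/-- Bounded un-continuous functionals (the un-dual). -/
def IsBoundedUnContinuous (f : E →ₗ[ℝ] ℝ) : Prop :=
  Continuous f ∧
  ∀ (A : Type u) [Preorder A] [IsDirectedOrder A] [Nonempty A] (x : A → E),
    IsNormBoundedFamily x → UnConvergesTo x 0 → Tendsto (fun a => f (x a)) atTop (𝓝 0)

/-- Bounded d-continuous functionals (the d-dual).  The index set has no maximal element: a net
whose index set has a largest element converges to its last term, and a one-term net is disjoint
for trivial reasons. -/
def IsBoundedDContinuous (f : E →ₗ[ℝ] ℝ) : Prop :=
  Continuous f ∧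
  ∀ (A : Type u) [Preorder A] [IsDirectedOrder A] [Nonempty A] [NoMaxOrder A] (x : A → E),
    IsNormBoundedFamily x → IsDisjointFamily x → Tendsto (fun a => f (x a)) atTop (𝓝 0)

/-- The usual order of linear functionals on a Riesz space: `φ ≤ ψ` iff `ψ - φ` is positive. -/
instance linearFunctionalPartialOrder [IsOrderedAddMonoid E] : PartialOrder (E →ₗ[ℝ] ℝ) where
  le φ ψ := ∀ x : E, 0 ≤ x → φ x ≤ ψ x
  le_refl _ _ _ := le_rfl
  le_trans _ _ _ h₁ h₂ x hx := (h₁ x hx).trans (h₂ x hx)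
  le_antisymm φ ψ h₁ h₂ := by
    ext x
    have key : ∀ z : E, 0 ≤ z → φ z = ψ z := fun z hz => le_antisymm (h₁ z hz) (h₂ z hz)
    rw [← posPart_sub_negPart x, map_sub, map_sub, key _ (posPart_nonneg x),
      key _ (negPart_nonneg x)]

/-- `g` is the modulus `|f| = f ∨ (-f)`. -/
def IsModulus [IsOrderedAddMonoid E] (f g : E →ₗ[ℝ] ℝ) : Prop :=
  IsLUB {f, -f} g

/-- The modulus `|f|` exists, and every disjoint sequence of the order interval `[0, |f|]` of the
norm dual is norm null.  Disjointness of positive functionals `φ`, `ψ` means `φ ∧ ψ = 0`.  (On a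
Banach lattice all positive functionals are norm continuous, so that the order interval is the
same in the order dual and in the norm dual.) -/
def DisjointSeqBelowModulusNormNull [IsOrderedAddMonoid E] (f : E →ₗ[ℝ] ℝ) : Prop :=
  ∃ g : E →ₗ[ℝ] ℝ, IsModulus f g ∧
    ∀ φ : ℕ → StrongDual ℝ E,
      (∀ n, 0 ≤ (φ n).toLinearMap ∧ (φ n).toLinearMap ≤ g) →
      (∀ m n, m ≠ n → IsGLB {(φ m).toLinearMap, (φ n).toLinearMap} 0) →
      Tendsto (fun n => ‖φ n‖) atTop (𝓝 0)

end Functionals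

/-!
The common core of the equivalence is the modulus `g = |f|`. An order continuous functional is
bounded on order intervals, so the Riesz–Kantorovich formula yields the positive part `P` of `f`
and `g = 2 P - f`; additive positive functions on the cone of a Banach lattice extend to continuous
linear functionals (`exists_dual_of_additive_on_cone`), hence `f` and `g` are norm continuous, and
`g` is order continuous with `f` (`IsModulus.tendsto_of_orderConvergesTo`).

Each of the continuity conditions implies that `f (x n) → 0` along bounded disjoint sequences,
because such sequences are `uo`-null (`orderConvergesTo_zero_of_disjoint`), `uaw`-null (the sum of
disjoint elements of `[0, w]` is at most `w`, so that `∑ ψ (|x n| ⊓ w) ≤ ψ w` for the modulus `ψ` of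
any element of the dual), and `un`-null when the norm is order continuous.

Conversely, if `f` tends to `0` along bounded disjoint sequences, then so does `g`, and a disjoint
sequence argument (`exists_forall_apply_posPart_sub_lt`) shows that for all `C`, `ε > 0` there is
`w ≥ 0` with `g (x - w)⁺ < ε` whenever `0 ≤ x` and `‖x‖ ≤ C`. From
`|f x| ≤ g (|x| ⊓ w) + g (|x| - w)⁺` the continuity of `f` along bounded nets reduces to
`g (|x a| ⊓ w) → 0`, which is clear for `uo`-, `uaw`-, `un`-null and for disjoint nets.

The same uniform estimate gives `‖φ n‖ → 0` for disjoint `φ n ∈ [0, g]`, since `φ n w → 0` by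
`∑ φ n w ≤ g w`. In the other direction, the components `a ↦ sup_k g (a ⊓ k |x n|)` of `g` in the
directions of a disjoint sequence are disjoint functionals in `[0, g]` which agree with `g` at
`|x n|`, so that `|f (x n)| ≤ ‖φ n‖ ‖x n‖`.
-/

/-! ### Riesz space preliminaries -/

section Lattice

variable {E : Type u} [Lattice E] [AddCommGroup E] [IsOrderedAddMonoid E]

theorem add_inf_le_inf_add_inf {a b c : E} (ha : 0 ≤ a) (hb : 0 ≤ b) (hc : 0 ≤ c) :
    (a + b) ⊓ c ≤ a ⊓ c + b ⊓ c := by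
  rw [add_inf, inf_add, inf_add]
  refine le_inf (le_inf inf_le_left ?_) (le_inf ?_ ?_)
  · exact inf_le_right.trans (le_add_of_nonneg_right hb)
  · exact inf_le_right.trans (le_add_of_nonneg_left ha)
  · exact inf_le_right.trans (le_add_of_nonneg_left hc)

theorem add_inf_eq_zero {a b c : E} (ha : 0 ≤ a) (hb : 0 ≤ b) (hc : 0 ≤ c)
    (hac : a ⊓ c = 0) (hbc : b ⊓ c = 0) : (a + b) ⊓ c = 0 := by
  refine le_antisymm ?_ (le_inf (add_nonneg ha hb) hc)
  simpa [hac, hbc] using add_inf_le_inf_add_inf ha hb hc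

theorem nsmul_inf_eq_zero {a c : E} (ha : 0 ≤ a) (hc : 0 ≤ c) (hac : a ⊓ c = 0) (k : ℕ) :
    (k • a) ⊓ c = 0 := by
  induction k with
  | zero => simpa using hc
  | succ k ih => rw [succ_nsmul]; exact add_inf_eq_zero (nsmul_nonneg ha k) ha hc ih hac

omit [IsOrderedAddMonoid E] in
theorem inf_eq_zero_mono {a b a' b' : E} (ha' : 0 ≤ a') (hb' : 0 ≤ b') (ha : a' ≤ a)
    (hb : b' ≤ b) (h : a ⊓ b = 0) : a' ⊓ b' = 0 :=
  le_antisymm ((inf_le_inf ha hb).trans h.le) (le_inf ha' hb')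

theorem add_le_of_inf_eq_zero {a b c : E} (h : a ⊓ b = 0) (ha : a ≤ c) (hb : b ≤ c) :
    a + b ≤ c := by
  rw [← inf_add_sup a b, h, zero_add]
  exact sup_le ha hb

theorem inf_add_posPart_sub (a b : E) : a ⊓ b + (a - b)⁺ = a := by
  rw [inf_eq_sub_posPart_sub, sub_add_cancel]

omit [IsOrderedAddMonoid E] in
theorem posPart_le_of_le {a b : E} (hb : 0 ≤ b) (h : a ≤ b) : a⁺ ≤ b :=
  sup_le h hb

theorem posPart_le_posPart_sub_add {a b : E} (hb : 0 ≤ b) : a⁺ ≤ (a - b)⁺ + b :=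
  posPart_le_of_le (add_nonneg (posPart_nonneg _) hb) (sub_le_iff_le_add.1 (le_posPart _))

/-- Disjoint elements below `w` have their sum below `w`, because their sum is their supremum. -/
theorem sum_le_of_disjoint {ι : Type*} {a : ι → E} {w : E} (ha : ∀ i, 0 ≤ a i)
    (hd : ∀ i j, i ≠ j → a i ⊓ a j = 0) (hw : 0 ≤ w) (haw : ∀ i, a i ≤ w) (s : Finset ι) :
    ∑ i ∈ s, a i ≤ w := by
  classical
  suffices h : ∑ i ∈ s, a i ≤ w ∧ ∀ j ∉ s, (∑ i ∈ s, a i) ⊓ a j = 0 from h.1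
  induction s using Finset.induction_on with
  | empty => simpa [hw] using ha
  | insert i s hi ih =>
    rw [Finset.sum_insert hi]
    refine ⟨add_le_of_inf_eq_zero (inf_comm (a i) _ ▸ ih.2 i hi) (haw i) ih.1, fun j hj => ?_⟩
    rw [Finset.mem_insert, not_or] at hj
    exact add_inf_eq_zero (ha i) (Finset.sum_nonneg fun k _ => ha k) (ha j) (hd i j (Ne.symm hj.1))
      (ih.2 j hj.2)

theorem inf_disjoint {x : E} {y w : E} (hw : 0 ≤ w) (h : |x| ⊓ |y| = 0) :
    (|x| ⊓ w) ⊓ (|y| ⊓ w) = 0 :=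
  inf_eq_zero_mono (le_inf (abs_nonneg x) hw) (le_inf (abs_nonneg y) hw) inf_le_left inf_le_left h

end Lattice

section Normed

variable {E : Type u} [NormedAddCommGroup E] [Lattice E] [HasSolidNorm E] [IsOrderedAddMonoid E]

theorem norm_le_norm_of_nonneg_of_le {a b : E} (ha : 0 ≤ a) (h : a ≤ b) : ‖a‖ ≤ ‖b‖ :=
  norm_le_norm_of_abs_le_abs (by rwa [abs_of_nonneg ha, abs_of_nonneg (ha.trans h)])

/-- A normed lattice is Archimedean. -/
theorem eq_zero_of_forall_nsmul_le [NormedSpace ℝ E] {a b : E} (ha : 0 ≤ a)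
    (h : ∀ n : ℕ, n • a ≤ b) : a = 0 := by
  by_contra hne
  obtain ⟨n, hn⟩ := exists_nat_gt (‖b‖ / ‖a‖)
  rw [div_lt_iff₀ (norm_pos_iff.2 hne)] at hn
  have := norm_le_norm_of_nonneg_of_le (nsmul_nonneg ha n) (h n)
  rw [← Nat.cast_smul_eq_nsmul ℝ, norm_smul, Real.norm_natCast] at this
  exact absurd this (not_le.2 hn)

end Normed

/-! ### Positive functionals -/

section Positive

variable {E : Type u} [NormedAddCommGroup E] [NormedSpace ℝ E] [CompleteSpace E] [Lattice E]
  [IsOrderedAddMonoid E] [HasSolidNorm E]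

/-- Positive additive maps on a Banach lattice are continuous: otherwise there are `x n` with
`‖x n‖ ≤ 4⁻ⁿ` and `q |x n|` bounded below, and `q` would be infinite at `∑ 2ⁿ |x n|`. -/
theorem AddMonoidHom.continuous_of_nonneg (q : E →+ ℝ) (hq : ∀ a, 0 ≤ a → 0 ≤ q a) :
    Continuous q := by
  have hmono : ∀ a b, a ≤ b → q a ≤ q b := fun a b h => by
    have := hq (b - a) (sub_nonneg.2 h)
    rw [map_sub] at this; linarith
  have habs : ∀ a, |q a| ≤ q |a| := fun a => abs_le'.2
    ⟨hmono _ _ (le_abs_self a), by rw [← map_neg]; exact hmono _ _ (neg_le_abs a)⟩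
  refine continuous_of_continuousAt_zero q ?_
  rw [Metric.continuousAt_iff]
  by_contra! hcon
  obtain ⟨ε, hε, hcon⟩ := hcon
  have hx : ∀ n : ℕ, ∃ x : E, ‖x‖ < (1 / 4 : ℝ) ^ n ∧ ε ≤ q |x| := fun n => by
    obtain ⟨x, hx, hx'⟩ := hcon ((1 / 4 : ℝ) ^ n) (by positivity)
    rw [dist_zero_right] at hx
    rw [map_zero, dist_zero_right, Real.norm_eq_abs] at hx'
    exact ⟨x, hx, hx'.trans (habs x)⟩
  choose x hx hxε using hx
  have hnorm : ∀ n, ‖(2 ^ n : ℕ) • |x n|‖ ≤ (1 / 2 : ℝ) ^ n := fun n => by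
    rw [← Nat.cast_smul_eq_nsmul ℝ, norm_smul, Real.norm_natCast, norm_abs_eq_norm]
    calc ((2 ^ n : ℕ) : ℝ) * ‖x n‖ ≤ 2 ^ n * (1 / 4) ^ n := by
          push_cast; gcongr; exact (hx n).le
      _ = (1 / 2) ^ n := by rw [← mul_pow]; norm_num
  have hs : Summable fun n => (2 ^ n : ℕ) • |x n| :=
    Summable.of_norm_bounded summable_geometric_two hnorm
  set y := ∑' n, (2 ^ n : ℕ) • |x n| with hy
  obtain ⟨n, hn⟩ := pow_unbounded_of_one_lt (q y / ε) (one_lt_two (α := ℝ))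
  rw [div_lt_iff₀ hε] at hn
  have h1 : (2 ^ n : ℕ) • |x n| ≤ y :=
    hs.le_tsum n fun m _ => nsmul_nonneg (abs_nonneg _) _
  have h2 := hmono _ _ h1
  rw [map_nsmul, nsmul_eq_mul] at h2
  push_cast at h2
  nlinarith [hxε n, pow_pos (zero_lt_two (α := ℝ)) n]

theorem LinearMap.continuous_of_nonneg (h : E →ₗ[ℝ] ℝ) (hh : ∀ a, 0 ≤ a → 0 ≤ h a) :
    Continuous h :=
  AddMonoidHom.continuous_of_nonneg h.toAddMonoidHom hh

/-- Kantorovich's extension: an additive nonnegative function on the positive cone of a Banach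
lattice is the restriction of a unique positive functional, which is continuous. Homogeneity
over `ℝ` is a consequence of continuity. -/
theorem exists_dual_of_additive_on_cone (p : E → ℝ) (hp : ∀ a, 0 ≤ a → 0 ≤ p a)
    (hadd : ∀ a b, 0 ≤ a → 0 ≤ b → p (a + b) = p a + p b) :
    ∃ g : StrongDual ℝ E, ∀ a, 0 ≤ a → g a = p a := by
  have hdiff : ∀ x a b : E, 0 ≤ a → 0 ≤ b → x = a - b → p x⁺ - p x⁻ = p a - p b := by
    intro x a b ha hb hx
    have h1 : a + x⁻ = b + x⁺ := by
      rw [add_comm b, ← sub_eq_sub_iff_add_eq_add.1 ((posPart_sub_negPart x).trans hx)]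
    have h2 := congrArg p h1
    rw [hadd _ _ ha (negPart_nonneg x), hadd _ _ hb (posPart_nonneg x)] at h2
    linarith
  let q : E →+ ℝ := AddMonoidHom.mk' (fun x => p x⁺ - p x⁻) fun x y => by
    have h := hdiff (x + y) (x⁺ + y⁺) (x⁻ + y⁻) (add_nonneg (posPart_nonneg x) (posPart_nonneg y))
      (add_nonneg (negPart_nonneg x) (negPart_nonneg y))
      (by nth_rewrite 1 [← posPart_sub_negPart x, ← posPart_sub_negPart y]; abel)
    rw [hadd _ _ (posPart_nonneg x) (posPart_nonneg y),
      hadd _ _ (negPart_nonneg x) (negPart_nonneg y)] at h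
    change p (x + y)⁺ - p (x + y)⁻ = (p x⁺ - p x⁻) + (p y⁺ - p y⁻)
    linarith
  have hp0 : p 0 = 0 := by simpa using hadd 0 0 le_rfl le_rfl
  have hq : ∀ a, 0 ≤ a → q a = p a := fun a ha => by
    have := hdiff a a 0 ha le_rfl (sub_zero a).symm
    rw [hp0, sub_zero] at this
    exact this
  refine ⟨q.toRealLinearMap (q.continuous_of_nonneg fun a ha => (hq a ha).symm ▸ hp a ha), ?_⟩
  exact hq

end Positive

/-! ### Order bounded functionals and their moduli -/

section Modulus

variable {E : Type u} [NormedAddCommGroup E] [NormedSpace ℝ E] [Lattice E] [IsOrderedAddMonoid E]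

/-- The functional `P` is given on the positive cone by the Riesz–Kantorovich formula for the
positive part of `f`. -/
def IsRieszKantorovichPosPart (f : E →ₗ[ℝ] ℝ) (P : StrongDual ℝ E) : Prop :=
  ∀ a, 0 ≤ a → IsLUB (f '' Set.Icc 0 a) (P a)

theorem exists_isRieszKantorovichPosPart [CompleteSpace E] [HasSolidNorm E] (f : E →ₗ[ℝ] ℝ)
    (hf : ∀ a, 0 ≤ a → BddAbove (f '' Set.Icc 0 a)) :
    ∃ P : StrongDual ℝ E, IsRieszKantorovichPosPart f P := by
  have hne : ∀ a : E, 0 ≤ a → (f '' Set.Icc 0 a).Nonempty := fun a ha =>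
    ⟨f 0, 0, ⟨le_rfl, ha⟩, rfl⟩
  have hlub : ∀ a, 0 ≤ a → IsLUB (f '' Set.Icc 0 a) (sSup (f '' Set.Icc 0 a)) := fun a ha =>
    isLUB_csSup (hne a ha) (hf a ha)
  obtain ⟨P, hP⟩ := exists_dual_of_additive_on_cone (fun a => sSup (f '' Set.Icc 0 a))
    (fun a ha => (hlub a ha).1 ⟨0, ⟨le_rfl, ha⟩, map_zero f⟩) (fun a b ha hb => by
      refine (hlub _ (add_nonneg ha hb)).unique ⟨?_, fun c hc => ?_⟩
      · rintro _ ⟨v, ⟨hv0, hv⟩, rfl⟩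
        -- Riesz decomposition of `v ∈ [0, a + b]`
        have h1 : f (v ⊓ a) ≤ _ := (hlub a ha).1 ⟨v ⊓ a, ⟨le_inf hv0 ha, inf_le_right⟩, rfl⟩
        have h2 : f (v - a)⁺ ≤ _ := (hlub b hb).1
          ⟨(v - a)⁺, ⟨posPart_nonneg _, posPart_le_of_le hb (sub_le_iff_le_add'.2 hv)⟩, rfl⟩
        have h3 := congrArg f (inf_add_posPart_sub v a)
        rw [map_add] at h3
        linarith
      · have h1 : sSup (f '' Set.Icc 0 a) ≤ c - sSup (f '' Set.Icc 0 b) := by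
          refine (hlub a ha).2 ?_
          rintro _ ⟨v, ⟨hv0, hv⟩, rfl⟩
          rw [le_sub_comm]
          refine (hlub b hb).2 ?_
          rintro _ ⟨w, ⟨hw0, hw⟩, rfl⟩
          have := hc ⟨v + w, ⟨add_nonneg hv0 hw0, add_le_add hv hw⟩, rfl⟩
          rw [map_add] at this
          linarith
        linarith)
  exact ⟨P, fun a ha => by rw [hP a ha]; exact hlub a ha⟩

namespace IsRieszKantorovichPosPart

variable {f : E →ₗ[ℝ] ℝ} {P : StrongDual ℝ E}

omit [IsOrderedAddMonoid E] in
theorem le (hP : IsRieszKantorovichPosPart f P) {v a : E} (hv : 0 ≤ v) (h : v ≤ a) : f v ≤ P a :=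
  (hP a (hv.trans h)).1 ⟨v, ⟨hv, h⟩, rfl⟩

omit [IsOrderedAddMonoid E] in
theorem nonneg (hP : IsRieszKantorovichPosPart f P) {a : E} (ha : 0 ≤ a) : 0 ≤ P a := by
  simpa using hP.le le_rfl ha

omit [IsOrderedAddMonoid E] in
theorem exists_lt (hP : IsRieszKantorovichPosPart f P) {a : E} (ha : 0 ≤ a) {ε : ℝ} (hε : 0 < ε) :
    ∃ v, 0 ≤ v ∧ v ≤ a ∧ P a < f v + ε := by
  obtain ⟨_, ⟨v, ⟨hv0, hv⟩, rfl⟩, h, -⟩ := (hP a ha).exists_between (sub_lt_self (P a) hε)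
  exact ⟨v, hv0, hv, sub_lt_iff_lt_add.1 h⟩

theorem continuous [CompleteSpace E] [HasSolidNorm E] (hP : IsRieszKantorovichPosPart f P) :
    Continuous f := by
  have h : Continuous (P.toLinearMap - f) := LinearMap.continuous_of_nonneg _ fun a ha =>
    sub_nonneg.2 (hP.le ha le_rfl)
  have h2 := P.continuous.sub h
  refine h2.congr fun x => ?_
  simp

/-- The modulus of `f` is `2 f⁺ - f`. -/
theorem isModulus (hP : IsRieszKantorovichPosPart f P) :
    IsModulus f (2 • P.toLinearMap - f) := by
  refine ⟨?_, fun h hh => ?_⟩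
  · rintro _ (rfl | rfl)
    · intro a ha
      have := hP.le ha le_rfl
      simp only [LinearMap.sub_apply, LinearMap.smul_apply, ContinuousLinearMap.coe_coe,
        nsmul_eq_mul, Nat.cast_ofNat]
      linarith
    · intro a ha
      have := hP.nonneg ha
      simp only [LinearMap.sub_apply, LinearMap.smul_apply, ContinuousLinearMap.coe_coe,
        nsmul_eq_mul, Nat.cast_ofNat, LinearMap.neg_apply]
      linarith
  · intro a ha
    have h1 : f ≤ h := hh (by simp)
    have h2 : -f ≤ h := hh (by simp)
    have h3 : P a ≤ (h a + f a) / 2 := by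
      refine (hP a ha).2 ?_
      rintro _ ⟨v, ⟨hv0, hv⟩, rfl⟩
      have h4 := h1 v hv0
      have h5 := h2 (a - v) (sub_nonneg.2 hv)
      rw [LinearMap.neg_apply, map_sub, map_sub] at h5
      linarith
    simp only [LinearMap.sub_apply, LinearMap.smul_apply, ContinuousLinearMap.coe_coe,
      nsmul_eq_mul, Nat.cast_ofNat]
    linarith

end IsRieszKantorovichPosPart

theorem IsModulus.nonneg {f g : E →ₗ[ℝ] ℝ} (hg : IsModulus f g) {a : E} (ha : 0 ≤ a) :
    0 ≤ g a := by
  have h1 := hg.1 (show f ∈ _ by simp) a ha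
  have h2 := hg.1 (show -f ∈ _ by simp) a ha
  rw [LinearMap.neg_apply] at h2
  linarith

theorem LinearMap.mono_of_nonneg {g : E →ₗ[ℝ] ℝ} (hg : ∀ a, 0 ≤ a → 0 ≤ g a) {a b : E}
    (h : a ≤ b) : g a ≤ g b := by
  have := hg (b - a) (sub_nonneg.2 h)
  rw [map_sub] at this
  linarith

theorem IsModulus.abs_apply_le {f g : E →ₗ[ℝ] ℝ} (hg : IsModulus f g) (x : E) :
    |f x| ≤ g |x| := by
  have h : ∀ a, 0 ≤ a → |f a| ≤ g a := fun a ha =>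
    abs_le'.2 ⟨hg.1 (show f ∈ _ by simp) a ha, hg.1 (show -f ∈ _ by simp) a ha⟩
  have h1 := h _ (posPart_nonneg x)
  have h2 := h _ (negPart_nonneg x)
  rw [← posPart_add_negPart x, map_add]
  nth_rewrite 1 [← posPart_sub_negPart x]
  rw [map_sub]
  exact (abs_sub _ _).trans (add_le_add h1 h2)

/-- A functional bounded above on the intervals `[0, a]` is continuous and has a continuous
modulus `g`; the last clause says that `g a` is the supremum of `f` over `[-a, a]`. -/
theorem exists_modulus [CompleteSpace E] [HasSolidNorm E] (f : E →ₗ[ℝ] ℝ)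
    (hf : ∀ a, 0 ≤ a → BddAbove (f '' Set.Icc 0 a)) :
    Continuous f ∧ ∃ g : StrongDual ℝ E, IsModulus f g.toLinearMap ∧
      ∀ a, 0 ≤ a → ∀ ε, 0 < ε → ∃ w, |w| ≤ a ∧ g a < f w + ε := by
  obtain ⟨P, hP⟩ := exists_isRieszKantorovichPosPart f hf
  refine ⟨hP.continuous, 2 • P - ⟨f, hP.continuous⟩, ?_, fun a ha ε hε => ?_⟩
  · exact hP.isModulus
  · obtain ⟨v, hv0, hv, h⟩ := hP.exists_lt ha (half_pos hε)
    refine ⟨v - (a - v), abs_le'.2 ⟨?_, ?_⟩, ?_⟩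
    · exact (sub_le_self _ (sub_nonneg.2 hv)).trans hv
    · rw [neg_sub]
      exact (sub_le_self _ hv0).trans (sub_le_self _ hv0)
    · simp only [sub_apply, smul_apply, nsmul_eq_mul,
        Nat.cast_ofNat, ContinuousLinearMap.coe_mk', map_sub]
      linarith

theorem bddAbove_image_Icc_of_continuous [HasSolidNorm E] (f : StrongDual ℝ E) (a : E) :
    BddAbove (f '' Set.Icc 0 a) := by
  refine ⟨‖f‖ * ‖a‖, ?_⟩
  rintro _ ⟨v, ⟨hv0, hv⟩, rfl⟩
  calc f v ≤ ‖f v‖ := Real.le_norm_self _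
    _ ≤ ‖f‖ * ‖v‖ := f.le_opNorm v
    _ ≤ ‖f‖ * ‖a‖ := by gcongr; exact norm_le_norm_of_nonneg_of_le hv0 hv

end Modulus

/-! ### Order convergence and order continuous functionals -/

section Order

variable {E : Type u} [NormedAddCommGroup E] [NormedSpace ℝ E] [Lattice E] [IsOrderedAddMonoid E]

omit [NormedSpace ℝ E] [IsOrderedAddMonoid E] in
theorem DecreasesToZero.nonneg {B : Type v} [Preorder B] {y : B → E} (hy : DecreasesToZero y)
    (b : B) : 0 ≤ y b :=
  hy.2.1 ⟨b, rfl⟩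

omit [NormedSpace ℝ E] [IsOrderedAddMonoid E] in
theorem OrderConvergesTo.comp_down {x : ℕ → E} {l : E} (h : OrderConvergesTo x l) :
    OrderConvergesTo (fun n : ULift.{u} ℕ => x n.down) l := by
  obtain ⟨B, i1, i2, i3, y, hy, hxy⟩ := h
  refine ⟨B, i1, i2, i3, y, hy, fun b => ?_⟩
  obtain ⟨n, hn⟩ := hxy b
  exact ⟨⟨n⟩, fun m hm => hn m.down hm⟩

theorem tendsto_of_tendsto_down {X : Type*} {l : Filter X} {x : ℕ → X}
    (h : Tendsto (fun n : ULift.{u} ℕ => x n.down) atTop l) : Tendsto x atTop l :=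
  h.comp (tendsto_atTop_atTop.2 fun b => ⟨b.down, fun _ ha => ha⟩ :
    Tendsto (ULift.up : ℕ → ULift.{u} ℕ) atTop atTop)

omit [NormedSpace ℝ E] in
theorem DecreasesToZero.orderConvergesTo {B : Type u} [Preorder B] [IsDirectedOrder B] [Nonempty B]
    {y x : B → E} (hy : DecreasesToZero y) (hx : ∀ b, 0 ≤ x b) (hxy : ∀ b, x b ≤ y b) :
    OrderConvergesTo x 0 := by
  refine ⟨B, inferInstance, inferInstance, inferInstance, y, hy, fun b => ⟨b, fun a ha => ?_⟩⟩
  rw [sub_zero, abs_of_nonneg (hx a)]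
  exact (hxy a).trans (hy.1 ha)

/-- Order continuous functionals are order bounded: if `f (v n) > n + 1` with `v n ∈ [0, a]`,
then `v n / (n + 1)` is order null. -/
theorem IsOrderContinuousFunctional.bddAbove [IsOrderedModule ℝ E] [HasSolidNorm E]
    {f : E →ₗ[ℝ] ℝ} (hf : IsOrderContinuousFunctional f) (a : E) (ha : 0 ≤ a) :
    BddAbove (f '' Set.Icc 0 a) := by
  by_contra hcon
  rw [not_bddAbove_iff] at hcon
  have hv : ∀ n : ℕ, ∃ v, 0 ≤ v ∧ v ≤ a ∧ (n + 1 : ℝ) < f v := fun n => by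
    obtain ⟨_, ⟨v, ⟨hv0, hv⟩, rfl⟩, h⟩ := hcon (n + 1)
    exact ⟨v, hv0, hv, h⟩
  choose v hv0 hva hfv using hv
  have hpos : ∀ n : ℕ, (0 : ℝ) < ((n : ℝ) + 1)⁻¹ := fun n => by positivity
  have hy : DecreasesToZero fun n : ULift.{u} ℕ => ((n.down : ℝ) + 1)⁻¹ • a := by
    refine ⟨fun m n hmn => ?_, ?_, fun z hz => ?_⟩
    · refine smul_le_smul_of_nonneg_right ?_ ha
      have : (m.down : ℝ) ≤ n.down := Nat.cast_le.2 hmn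
      gcongr
    · rintro _ ⟨n, rfl⟩
      exact smul_nonneg (hpos _).le ha
    · have h0 : z⁺ = 0 := by
        refine eq_zero_of_forall_nsmul_le (b := a) (posPart_nonneg z) fun n => ?_
        have h1 : z⁺ ≤ ((n : ℝ) + 1)⁻¹ • a :=
          posPart_le_of_le (smul_nonneg (hpos n).le ha) (hz ⟨⟨n⟩, rfl⟩)
        calc n • z⁺ ≤ (n + 1) • z⁺ := nsmul_le_nsmul_left (posPart_nonneg z) n.le_succ
          _ ≤ (n + 1) • (((n : ℝ) + 1)⁻¹ • a) := nsmul_le_nsmul_right h1 _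
          _ = a := by
            rw [← Nat.cast_smul_eq_nsmul ℝ, smul_smul, Nat.cast_succ,
              mul_inv_cancel₀ (by positivity), one_smul]
      exact posPart_eq_zero.1 h0
  have h1 := hf (ULift.{u} ℕ) (fun n => ((n.down : ℝ) + 1)⁻¹ • v n.down)
    (hy.orderConvergesTo (fun n => smul_nonneg (hpos _).le (hv0 _))
      fun n => smul_le_smul_of_nonneg_left (hva _) (hpos _).le)
  have h2 : ∀ᶠ n : ULift.{u} ℕ in atTop, f (((n.down : ℝ) + 1)⁻¹ • v n.down) < 1 :=
    h1.eventually (gt_mem_nhds one_pos)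
  obtain ⟨n, hn⟩ := h2.exists
  rw [map_smul, smul_eq_mul, inv_mul_lt_iff₀ (by positivity), mul_one] at hn
  exact lt_asymm hn (hfv _)

/-- The positive part of an order continuous functional is order continuous. If `v ∈ [0, y b₀]`
almost attains `f⁺ (y b₀)`, then `f⁺ (y b) ≤ f⁺ (y b₀) - f v + f (v ⊓ y b)` for `b ≥ b₀`, since
`v - v ⊓ y b ≤ y b₀ - y b`. -/
theorem IsRieszKantorovichPosPart.tendsto_of_decreasesToZero {f : E →ₗ[ℝ] ℝ} {P : StrongDual ℝ E}
    (hP : IsRieszKantorovichPosPart f P) (hf : IsOrderContinuousFunctional f)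
    {B : Type u} [Preorder B] [IsDirectedOrder B] [Nonempty B] {y : B → E}
    (hy : DecreasesToZero y) : Tendsto (fun b => P (y b)) atTop (𝓝 0) := by
  rw [tendsto_order]
  refine ⟨fun c hc => Eventually.of_forall fun b => hc.trans_le (hP.nonneg (hy.nonneg b)),
    fun ε hε => ?_⟩
  obtain ⟨b₀⟩ := ‹Nonempty B›
  obtain ⟨v, hv0, hv, hPv⟩ := hP.exists_lt (hy.nonneg b₀) (half_pos hε)
  have h1 := hf B (fun b => v ⊓ y b)
    (hy.orderConvergesTo (fun b => le_inf hv0 (hy.nonneg b)) fun b => inf_le_right)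
  filter_upwards [h1.eventually (gt_mem_nhds (half_pos hε)), eventually_ge_atTop b₀] with b hb hbb
  have h2 : f (v - y b)⁺ ≤ P (y b₀ - y b) := hP.le (posPart_nonneg _)
    (posPart_le_of_le (sub_nonneg.2 (hy.1 hbb)) (sub_le_sub_right hv _))
  have h3 := congrArg f (inf_add_posPart_sub v (y b))
  rw [map_add] at h3
  rw [map_sub] at h2
  linarith

/-- The modulus of an order continuous functional is order continuous. -/
theorem IsModulus.tendsto_of_orderConvergesTo [CompleteSpace E] [IsOrderedModule ℝ E]
    [HasSolidNorm E] {f g : E →ₗ[ℝ] ℝ} (hg : IsModulus f g) (hf : IsOrderContinuousFunctional f)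
    {A : Type v} [Preorder A] [IsDirectedOrder A] [Nonempty A] {x : A → E} (hx : ∀ a, 0 ≤ x a)
    (h : OrderConvergesTo x 0) : Tendsto (fun a => g (x a)) atTop (𝓝 0) := by
  obtain ⟨P, hP⟩ := exists_isRieszKantorovichPosPart f hf.bddAbove
  obtain rfl := hg.unique hP.isModulus
  obtain ⟨B, i1, i2, i3, y, hy, hxy⟩ := h
  have h1 : Tendsto (fun b => (2 • P.toLinearMap - f) (y b)) atTop (𝓝 0) := by
    have := ((hP.tendsto_of_decreasesToZero hf hy).const_mul 2).sub
      (hf B y (hy.orderConvergesTo hy.nonneg fun _ => le_rfl))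
    simpa using this
  rw [tendsto_order]
  refine ⟨fun c hc => Eventually.of_forall fun a => hc.trans_le (hg.nonneg (hx a)),
    fun ε hε => ?_⟩
  obtain ⟨b, hb⟩ := (h1.eventually (gt_mem_nhds hε)).exists
  obtain ⟨a₀, ha₀⟩ := hxy b
  filter_upwards [eventually_ge_atTop a₀] with a ha
  have h2 := ha₀ a ha
  rw [sub_zero, abs_of_nonneg (hx a)] at h2
  exact (LinearMap.mono_of_nonneg (fun _ => hg.nonneg) h2).trans_lt hb

/-- Disjoint sequences in an order interval `[0, w]` are order null. The dominating net consists
of all upper bounds of tails. If `z ≥ 0` is below all of them, then `z` is disjoint from each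
`x k`, because `w - w ⊓ N • x k` bounds a tail for all `N`; hence `y - z` bounds a tail whenever
`y` does, and `N • z ≤ w` for all `N`. -/
theorem orderConvergesTo_zero_of_disjoint [HasSolidNorm E] {x : ℕ → E} {w : E} (hx : ∀ n, 0 ≤ x n)
    (hxw : ∀ n, x n ≤ w) (hd : ∀ m n, m ≠ n → x m ⊓ x n = 0) : OrderConvergesTo x 0 := by
  have hw : 0 ≤ w := (hx 0).trans (hxw 0)
  let S : Set E := {y | ∃ n, ∀ m, n ≤ m → x m ≤ y}
  have hwS : w ∈ S := ⟨0, fun m _ => hxw m⟩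
  have hdir : IsDirectedOrder Sᵒᵈ := ⟨fun a b => by
    obtain ⟨m, hm⟩ := (OrderDual.ofDual a).2
    obtain ⟨n, hn⟩ := (OrderDual.ofDual b).2
    refine ⟨OrderDual.toDual ⟨(OrderDual.ofDual a).1 ⊓ (OrderDual.ofDual b).1, m ⊔ n,
      fun k hk => le_inf (hm k (le_sup_left.trans hk)) (hn k (le_sup_right.trans hk))⟩, ?_, ?_⟩
    · exact (inf_le_left : (OrderDual.ofDual a).1 ⊓ (OrderDual.ofDual b).1 ≤ _)
    · exact (inf_le_right : (OrderDual.ofDual a).1 ⊓ (OrderDual.ofDual b).1 ≤ _)⟩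
  refine ⟨Sᵒᵈ, inferInstance, hdir, ⟨OrderDual.toDual ⟨w, hwS⟩⟩,
    fun b => (OrderDual.ofDual b).1, ⟨fun a b hab => hab, ?_, fun z hz => ?_⟩, fun b => ?_⟩
  · rintro _ ⟨b, rfl⟩
    obtain ⟨n, hn⟩ := (OrderDual.ofDual b).2
    exact (hx n).trans (hn n le_rfl)
  · have hzS : ∀ y ∈ S, z⁺ ≤ y := fun y hy => by
      obtain ⟨n, hn⟩ := id hy
      exact posPart_le_of_le ((hx n).trans (hn n le_rfl)) (hz ⟨OrderDual.toDual ⟨y, hy⟩, rfl⟩)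
    have hz0 := posPart_nonneg z
    have hzx : ∀ k, x k ⊓ z⁺ = 0 := fun k => by
      refine eq_zero_of_forall_nsmul_le (b := w) (le_inf (hx k) hz0) fun N => ?_
      induction N with
      | zero => simpa using hw
      | succ N ih =>
        have h1 : w - w ⊓ N • x k ∈ S := by
          refine ⟨k + 1, fun m hm => le_sub_iff_add_le.2 ?_⟩
          refine add_le_of_inf_eq_zero ?_ (hxw m) inf_le_left
          rw [inf_comm]
          exact inf_eq_zero_mono (le_inf hw (nsmul_nonneg (hx k) N)) (hx m) inf_le_right le_rfl
            (nsmul_inf_eq_zero (hx k) (hx m) (hd k m (by omega)) N)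
        rw [succ_nsmul']
        calc x k ⊓ z⁺ + N • (x k ⊓ z⁺) ≤ z⁺ + w ⊓ N • x k :=
              add_le_add inf_le_right (le_inf ih (nsmul_le_nsmul_right inf_le_left N))
          _ ≤ w := le_sub_iff_add_le.1 (hzS _ h1)
    have hstep : ∀ y ∈ S, y - z⁺ ∈ S := fun y hy => by
      obtain ⟨n, hn⟩ := id hy
      exact ⟨n, fun m hm => le_sub_iff_add_le.2
        (add_le_of_inf_eq_zero (hzx m) (hn m hm) (hzS y hy))⟩
    have hall : ∀ N : ℕ, w - N • z⁺ ∈ S := fun N => by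
      induction N with
      | zero => simpa using hwS
      | succ N ih => rw [succ_nsmul, ← sub_sub]; exact hstep _ ih
    exact posPart_eq_zero.1 <| eq_zero_of_forall_nsmul_le hz0 fun N =>
      sub_nonneg.1 (hz0.trans (hzS _ (hall N)))
  · obtain ⟨n, hn⟩ := (OrderDual.ofDual b).2
    refine ⟨n, fun m hm => ?_⟩
    rw [sub_zero, abs_of_nonneg (hx m)]
    exact hn m hm

end Order

/-! ### Disjoint families and positive functionals -/

section Disjoint

variable {E : Type u} [NormedAddCommGroup E] [NormedSpace ℝ E] [Lattice E] [IsOrderedAddMonoid E]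

theorem tendsto_cofinite_of_disjoint {g : E →ₗ[ℝ] ℝ} (hg : ∀ a, 0 ≤ a → 0 ≤ g a) {ι : Type*}
    {a : ι → E} {w : E} (hw : 0 ≤ w) (ha : ∀ i, 0 ≤ a i) (haw : ∀ i, a i ≤ w)
    (hd : ∀ i j, i ≠ j → a i ⊓ a j = 0) : Tendsto (fun i => g (a i)) cofinite (𝓝 0) := by
  refine (summable_of_sum_le (c := g w) (fun i => hg _ (ha i)) fun s => ?_).tendsto_cofinite_zero
  rw [← map_sum]
  exact LinearMap.mono_of_nonneg hg (sum_le_of_disjoint ha hd hw haw s)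

/-- If a positive functional `g` tends to `0` along bounded disjoint sequences, then it is
uniformly small on the parts `(x - w)⁺` of the elements of a ball lying above a suitable `w`.
Otherwise there are `x n` in the ball with `g (x n - 4ⁿ (x 0 + ⋯ + x (n - 1)))⁺ ≥ ε`. With
`y = ∑ 2⁻ⁿ x n`, the elements `(x n - 4ⁿ (x 0 + ⋯ + x (n - 1)) - 2⁻ⁿ y)⁺` are disjoint, and the
correction `2⁻ⁿ y` changes the values of `g` by a null sequence only. -/
theorem exists_forall_apply_posPart_sub_lt [CompleteSpace E] [IsOrderedModule ℝ E]
    [HasSolidNorm E] {g : E →ₗ[ℝ] ℝ} (hg : ∀ a, 0 ≤ a → 0 ≤ g a)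
    (hd : ∀ x : ℕ → E, IsNormBoundedFamily x → (∀ n, 0 ≤ x n) → (∀ m n, m ≠ n → x m ⊓ x n = 0) →
      Tendsto (fun n => g (x n)) atTop (𝓝 0)) (C : ℝ) {ε : ℝ} (hε : 0 < ε) :
    ∃ w : E, 0 ≤ w ∧ ∀ x, 0 ≤ x → ‖x‖ ≤ C → g (x - w)⁺ < ε := by
  by_contra! hcon
  have hch : ∀ w : E, ∃ x, 0 ≤ x ∧ ‖x‖ ≤ C ∧ (0 ≤ w → ε ≤ g (x - w)⁺) := fun w => by
    by_cases hw : 0 ≤ w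
    · obtain ⟨x, h1, h2, h3⟩ := hcon w hw
      exact ⟨x, h1, h2, fun _ => h3⟩
    · obtain ⟨x, h1, h2, -⟩ := hcon 0 le_rfl
      exact ⟨x, h1, h2, fun h => absurd h hw⟩
  choose c hc0 hcC hcε using hch
  -- `s n` is the partial sum `x 0 + ⋯ + x (n - 1)`
  let s : ℕ → E := fun n => Nat.rec 0 (fun k t => t + c (4 ^ k • t)) n
  let x : ℕ → E := fun n => c (4 ^ n • s n)
  have hs : ∀ n, s (n + 1) = s n + x n := fun n => rfl
  have hx0 : ∀ n, 0 ≤ x n := fun n => hc0 _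
  have hs0 : ∀ n, 0 ≤ s n := fun n => by
    induction n with
    | zero => exact le_rfl
    | succ n ih => rw [hs]; exact add_nonneg ih (hx0 n)
  have hsmono : Monotone s := monotone_nat_of_le_succ fun n => by
    rw [hs]; exact le_add_of_nonneg_right (hx0 n)
  have hxs : ∀ n m, n < m → x n ≤ s m := fun n m hnm =>
    (le_add_of_nonneg_left (hs0 n)).trans ((hs n).symm.le.trans (hsmono hnm))
  have hsum : Summable fun n => (1 / 2 : ℝ) ^ n • x n := by
    refine Summable.of_norm_bounded (summable_geometric_two.mul_right C) fun n => ?_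
    rw [norm_smul, Real.norm_of_nonneg (by positivity)]
    gcongr
    exact hcC _
  set y := ∑' n, (1 / 2 : ℝ) ^ n • x n
  have hterm : ∀ n, 0 ≤ (1 / 2 : ℝ) ^ n • x n := fun n => smul_nonneg (by positivity) (hx0 n)
  have hy0 : 0 ≤ y := tsum_nonneg hterm
  have hxy : ∀ m, (1 / 2 : ℝ) ^ m • x m ≤ y := fun m => hsum.le_tsum m fun n _ => hterm n
  have hry0 : ∀ n : ℕ, 0 ≤ (1 / 2 : ℝ) ^ n • y := fun n => smul_nonneg (by positivity) hy0
  let z : ℕ → E := fun n => (x n - 4 ^ n • s n - (1 / 2 : ℝ) ^ n • y)⁺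
  have hz0 : ∀ n, 0 ≤ z n := fun n => posPart_nonneg _
  have h4s : ∀ n : ℕ, 0 ≤ 4 ^ n • s n := fun n => nsmul_nonneg (hs0 n) _
  have hzx : ∀ n, z n ≤ x n := fun n => posPart_le_of_le (hx0 n)
    ((sub_le_self _ (hry0 n)).trans (sub_le_self _ (h4s n)))
  -- for `n < m`, `z m` and `z n` lie below the positive and the negative part of `x m - 4ᵐ x n`
  have hdlt : ∀ n m, n < m → z m ⊓ z n = 0 := fun n m hnm => by
    refine inf_eq_zero_mono (hz0 m) (hz0 n) ?_ ?_
      (posPart_inf_negPart_eq_zero (x m - 4 ^ m • x n))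
    · exact posPart_mono ((sub_le_self _ (hry0 m)).trans
        (sub_le_sub_left (nsmul_le_nsmul_right (hxs n m hnm) _) _))
    · refine posPart_le_of_le (negPart_nonneg _) ?_
      have h1 : (1 / 4 : ℝ) ^ m • x m ≤ (1 / 2 : ℝ) ^ n • y := by
        calc (1 / 4 : ℝ) ^ m • x m = (1 / 2 : ℝ) ^ m • (1 / 2 : ℝ) ^ m • x m := by
              rw [smul_smul, ← mul_pow]; norm_num
          _ ≤ (1 / 2 : ℝ) ^ m • y := smul_le_smul_of_nonneg_left (hxy m) (by positivity)
          _ ≤ (1 / 2 : ℝ) ^ n • y := smul_le_smul_of_nonneg_right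
              (pow_le_pow_of_le_one (by norm_num) (by norm_num) hnm.le) hy0
      have h2 : x n - (1 / 4 : ℝ) ^ m • x m = (1 / 4 : ℝ) ^ m • -(x m - 4 ^ m • x n) := by
        rw [neg_sub, smul_sub, ← Nat.cast_smul_eq_nsmul ℝ (4 ^ m) (x n), smul_smul]
        push_cast
        rw [← mul_pow]
        norm_num
      calc x n - 4 ^ n • s n - (1 / 2 : ℝ) ^ n • y ≤ x n - (1 / 4 : ℝ) ^ m • x m :=
            sub_le_sub (sub_le_self _ (h4s n)) h1
        _ = (1 / 4 : ℝ) ^ m • -(x m - 4 ^ m • x n) := h2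
        _ ≤ (1 / 4 : ℝ) ^ m • (x m - 4 ^ m • x n)⁻ :=
            smul_le_smul_of_nonneg_left (neg_le_negPart _) (by positivity)
        _ ≤ (1 : ℝ) • (x m - 4 ^ m • x n)⁻ := smul_le_smul_of_nonneg_right
            (pow_le_one₀ (by norm_num) (by norm_num)) (negPart_nonneg _)
        _ = _ := one_smul _ _
  have hlim := hd z ⟨C, fun n => (norm_le_norm_of_nonneg_of_le (hz0 n) (hzx n)).trans (hcC _)⟩ hz0
    fun m n hmn => by
      rcases hmn.lt_or_gt with h | h
      · rw [inf_comm]; exact hdlt m n h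
      · exact hdlt n m h
  have hlim2 : Tendsto (fun n : ℕ => g (z n) + (1 / 2 : ℝ) ^ n * g y) atTop (𝓝 0) := by
    simpa using hlim.add ((tendsto_pow_atTop_nhds_zero_of_lt_one (r := (1 / 2 : ℝ)) (by norm_num)
      (by norm_num)).mul_const (g y))
  obtain ⟨n, hn⟩ := (hlim2.eventually (gt_mem_nhds hε)).exists
  have h1 := LinearMap.mono_of_nonneg hg
    (posPart_le_posPart_sub_add (a := x n - 4 ^ n • s n) (hry0 n))
  rw [map_add, map_smul, smul_eq_mul] at h1
  exact absurd (hcε _ (h4s n)) (not_le.2 (h1.trans_lt hn))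

/-- If `|f| ≤ g` and `g` is uniformly small on the parts of a ball above suitable elements, then
convergence of `f` along a bounded net reduces to that of `g` along the truncations of the net. -/
theorem tendsto_of_tendsto_truncations [HasSolidNorm E] {f g : E →ₗ[ℝ] ℝ}
    (hfg : ∀ x, |f x| ≤ g |x|)
    (hK : ∀ C ε : ℝ, 0 < ε → ∃ w : E, 0 ≤ w ∧ ∀ x, 0 ≤ x → ‖x‖ ≤ C → g (x - w)⁺ < ε)
    {A : Type v} {l : Filter A} {x : A → E} (hx : IsNormBoundedFamily x)
    (h : ∀ w, 0 ≤ w → Tendsto (fun a => g (|x a| ⊓ w)) l (𝓝 0)) :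
    Tendsto (fun a => f (x a)) l (𝓝 0) := by
  obtain ⟨C, hC⟩ := hx
  rw [Metric.tendsto_nhds]
  intro ε hε
  obtain ⟨w, hw, hwK⟩ := hK C (ε / 2) (half_pos hε)
  filter_upwards [(h w hw).eventually (gt_mem_nhds (half_pos hε))] with a ha
  have h1 := hwK |x a| (abs_nonneg _) (by rw [norm_abs_eq_norm]; exact hC a)
  have h2 := congrArg g (inf_add_posPart_sub |x a| w)
  rw [map_add] at h2
  rw [Real.dist_0_eq_abs]
  linarith [hfg (x a)]

/-- The modulus inherits continuity along bounded disjoint sequences: `g (x n)` is almost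
attained as `f (v n)` with `|v n| ≤ x n`, and the `v n` are disjoint again. -/
theorem tendsto_modulus_of_disjoint [HasSolidNorm E] {f g : E →ₗ[ℝ] ℝ}
    (hg : ∀ a, 0 ≤ a → 0 ≤ g a)
    (hgf : ∀ a, 0 ≤ a → ∀ ε, 0 < ε → ∃ w, |w| ≤ a ∧ g a < f w + ε)
    (hf : ∀ x : ℕ → E, IsNormBoundedFamily x → IsDisjointFamily x →
        Tendsto (fun n => f (x n)) atTop (𝓝 0))
    (x : ℕ → E) (hx : IsNormBoundedFamily x) (hx0 : ∀ n, 0 ≤ x n)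
    (hd : ∀ m n, m ≠ n → x m ⊓ x n = 0) : Tendsto (fun n => g (x n)) atTop (𝓝 0) := by
  have hv := fun n : ℕ => hgf (x n) (hx0 n) (1 / ((n : ℝ) + 1)) (by positivity)
  choose v hvx hgv using hv
  obtain ⟨C, hC⟩ := hx
  have h1 := hf v
    ⟨C, fun n => (norm_le_norm_of_abs_le_abs ((hvx n).trans (le_abs_self _))).trans (hC n)⟩
    fun m n hmn => inf_eq_zero_mono (abs_nonneg _) (abs_nonneg _) (hvx m) (hvx n) (hd m n hmn)
  refine squeeze_zero (fun n => hg _ (hx0 n)) (fun n => (hgv n).le) ?_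
  simpa using h1.add tendsto_one_div_add_atTop_nhds_zero_nat

end Disjoint

/-! ### Disjoint functionals -/

section DisjointFunctionals

variable {E : Type u} [NormedAddCommGroup E] [NormedSpace ℝ E] [Lattice E] [IsOrderedAddMonoid E]

/-- The infimum of the positive functionals `φ` and `ψ` vanishes, as expressed by the
Riesz–Kantorovich formula. -/
def AreDisjointFunctionals (φ ψ : E →ₗ[ℝ] ℝ) : Prop :=
  ∀ a, 0 ≤ a → ∀ ε, 0 < ε → ∃ v, 0 ≤ v ∧ v ≤ a ∧ φ v + ψ (a - v) < ε

theorem AreDisjointFunctionals.isGLB {φ ψ : E →ₗ[ℝ] ℝ} (hφ : 0 ≤ φ) (hψ : 0 ≤ ψ)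
    (h : AreDisjointFunctionals φ ψ) : IsGLB {φ, ψ} 0 := by
  refine ⟨?_, fun η hη a ha => ?_⟩
  · rintro _ (rfl | rfl) <;> assumption
  · refine le_of_forall_pos_lt_add fun ε hε => ?_
    obtain ⟨v, hv0, hv, hlt⟩ := h a ha ε hε
    have h1 := hη (show φ ∈ _ by simp) v hv0
    have h2 := hη (show ψ ∈ _ by simp) (a - v) (sub_nonneg.2 hv)
    have h3 : η a = η v + η (a - v) := by rw [← map_add, add_sub_cancel]
    rw [LinearMap.zero_apply]
    linarith

/-- The functional `(φ + ψ - |φ - ψ|) / 2` is a lower bound of `φ` and `ψ`. -/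
theorem AreDisjointFunctionals.of_isGLB [CompleteSpace E] [IsOrderedModule ℝ E] [HasSolidNorm E]
    {φ ψ : StrongDual ℝ E} (h : IsGLB {φ.toLinearMap, ψ.toLinearMap} 0) :
    AreDisjointFunctionals φ.toLinearMap ψ.toLinearMap := by
  intro a ha ε hε
  obtain ⟨-, g, hg, hgw⟩ := exists_modulus (φ - ψ).toLinearMap
    fun a _ => bddAbove_image_Icc_of_continuous (φ - ψ) a
  have h1 : (1 / 2 : ℝ) • (φ + ψ - g).toLinearMap ≤ 0 := by
    refine h.2 ?_
    rintro _ (rfl | rfl) <;> intro a ha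
    · have := hg.1 (show -(φ - ψ).toLinearMap ∈ _ by simp) a ha
      simp at this ⊢
      linarith
    · have := hg.1 (show (φ - ψ).toLinearMap ∈ _ by simp) a ha
      simp at this ⊢
      linarith
  have h2 := h1 a ha
  obtain ⟨w, hw, hgw⟩ := hgw a ha ε hε
  have hwa := (le_abs_self w).trans hw
  have hwa' := (neg_le_abs w).trans hw
  refine ⟨(1 / 2 : ℝ) • (a - w), smul_nonneg (by norm_num) (sub_nonneg.2 hwa), ?_, ?_⟩
  · rw [← sub_nonneg]
    have h3 : a - (1 / 2 : ℝ) • (a - w) = (1 / 2 : ℝ) • (a - -w) := by module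
    rw [h3]
    exact smul_nonneg (by norm_num) (sub_nonneg.2 hwa')
  · simp at h2 hgw ⊢
    linarith

theorem AreDisjointFunctionals.add_left {φ₁ φ₂ ψ : E →ₗ[ℝ] ℝ} (h1 : 0 ≤ φ₁) (h2 : 0 ≤ φ₂)
    (hψ : 0 ≤ ψ) (hd1 : AreDisjointFunctionals φ₁ ψ) (hd2 : AreDisjointFunctionals φ₂ ψ) :
    AreDisjointFunctionals (φ₁ + φ₂) ψ := by
  intro a ha ε hε
  obtain ⟨v, hv0, hv, hvε⟩ := hd1 a ha (ε / 2) (half_pos hε)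
  obtain ⟨w, hw0, hw, hwε⟩ := hd2 a ha (ε / 2) (half_pos hε)
  refine ⟨v ⊓ w, le_inf hv0 hw0, inf_le_left.trans hv, ?_⟩
  have e1 := LinearMap.mono_of_nonneg h1 (inf_le_left : v ⊓ w ≤ v)
  have e2 := LinearMap.mono_of_nonneg h2 (inf_le_right : v ⊓ w ≤ w)
  have e3 : ψ (a - v ⊓ w) ≤ ψ ((a - v) + (a - w)) := by
    refine LinearMap.mono_of_nonneg hψ ?_
    rw [sub_le_comm]
    refine le_inf (sub_le_comm.1 ?_) (sub_le_comm.1 ?_)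
    · exact le_add_of_nonneg_right (sub_nonneg.2 hw)
    · exact le_add_of_nonneg_left (sub_nonneg.2 hv)
  rw [map_add] at e3
  rw [LinearMap.add_apply]
  linarith

theorem AreDisjointFunctionals.add_le {φ ψ g : E →ₗ[ℝ] ℝ} (hφ : φ ≤ g) (hψ : ψ ≤ g)
    (hd : AreDisjointFunctionals ψ φ) : φ + ψ ≤ g := by
  intro a ha
  refine le_of_forall_pos_lt_add fun ε hε => ?_
  obtain ⟨v, hv0, hv, hvε⟩ := hd a ha ε hε
  have e1 := hφ v hv0
  have e2 := hψ (a - v) (sub_nonneg.2 hv)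
  simp only [LinearMap.add_apply, map_sub] at e2 hvε ⊢
  linarith

/-- Disjoint functionals in `[0, g]` have their sums below `g`. -/
theorem sum_le_of_areDisjointFunctionals {φ : ℕ → E →ₗ[ℝ] ℝ} {g : E →ₗ[ℝ] ℝ} (hg : 0 ≤ g)
    (hφ : ∀ n, 0 ≤ φ n ∧ φ n ≤ g) (hd : ∀ m n, m ≠ n → AreDisjointFunctionals (φ m) (φ n))
    (s : Finset ℕ) : ∑ i ∈ s, φ i ≤ g := by
  suffices h : 0 ≤ ∑ i ∈ s, φ i ∧ ∑ i ∈ s, φ i ≤ g ∧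
      ∀ j ∉ s, AreDisjointFunctionals (∑ i ∈ s, φ i) (φ j) from h.2.1
  induction s using Finset.induction_on with
  | empty =>
    refine ⟨le_rfl, hg, fun j _ a ha ε hε => ⟨a, ha, le_rfl, ?_⟩⟩
    simpa using hε
  | insert i s hi ih =>
    rw [Finset.sum_insert hi]
    refine ⟨fun a ha => add_nonneg ((hφ i).1 a ha) (ih.1 a ha), ?_, fun j hj => ?_⟩
    · exact (ih.2.2 i hi).add_le (hφ i).2 ih.2.1
    · rw [Finset.mem_insert, not_or] at hj
      exact (hd i j (Ne.symm hj.1)).add_left (hφ i).1 ih.1 (hφ j).1 (ih.2.2 j hj.2)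

/-- The component of a positive functional `g` in the direction of `x ≥ 0`:
`φ a = sup_k g (a ⊓ k x)` for `a ≥ 0`. -/
theorem exists_component [CompleteSpace E] [HasSolidNorm E] {g : E →ₗ[ℝ] ℝ} (hg : 0 ≤ g) {x : E}
    (hx : 0 ≤ x) : ∃ φ : StrongDual ℝ E, ∀ a, 0 ≤ a →
      IsLUB (Set.range fun k : ℕ => g (a ⊓ k • x)) (φ a) := by
  have hkx : ∀ k : ℕ, 0 ≤ k • x := nsmul_nonneg hx
  have hlub : ∀ a, 0 ≤ a → IsLUB (Set.range fun k : ℕ => g (a ⊓ k • x)) (⨆ k : ℕ, g (a ⊓ k • x)) :=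
    fun a ha => isLUB_ciSup ⟨g a, by
      rintro _ ⟨k, rfl⟩
      exact LinearMap.mono_of_nonneg hg inf_le_left⟩
  obtain ⟨φ, hφ⟩ := exists_dual_of_additive_on_cone (fun a => ⨆ k : ℕ, g (a ⊓ k • x))
    (fun a ha => (hg _ (le_inf ha (hkx 0))).trans ((hlub a ha).1 ⟨0, rfl⟩)) fun a b ha hb => by
      refine (hlub _ (add_nonneg ha hb)).unique ⟨?_, fun c hc => ?_⟩
      · rintro _ ⟨k, rfl⟩
        refine (LinearMap.mono_of_nonneg hg (add_inf_le_inf_add_inf ha hb (hkx k))).trans ?_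
        rw [map_add]
        exact add_le_add ((hlub a ha).1 ⟨k, rfl⟩) ((hlub b hb).1 ⟨k, rfl⟩)
      · change (⨆ k : ℕ, g (a ⊓ k • x)) + (⨆ k : ℕ, g (b ⊓ k • x)) ≤ c
        rw [← le_sub_iff_add_le]
        refine (hlub a ha).2 ?_
        rintro _ ⟨k, rfl⟩
        rw [le_sub_comm]
        refine (hlub b hb).2 ?_
        rintro _ ⟨j, rfl⟩
        rw [le_sub_iff_add_le, ← map_add]
        refine le_trans (LinearMap.mono_of_nonneg hg ?_) (hc ⟨j + k, rfl⟩)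
        rw [add_comm, add_nsmul]
        refine le_inf (add_le_add inf_le_left inf_le_left) ?_
        rw [add_comm]
        exact add_le_add inf_le_right inf_le_right
  exact ⟨φ, fun a ha => by rw [hφ a ha]; exact hlub a ha⟩

end DisjointFunctionals

/-! ### Functionals continuous along bounded disjoint sequences -/

section Equivalences

variable {E : Type u} [NormedAddCommGroup E] [NormedSpace ℝ E] [CompleteSpace E]
    [Lattice E] [IsOrderedAddMonoid E] [IsOrderedModule ℝ E] [HasSolidNorm E]

omit [CompleteSpace E] [IsOrderedModule ℝ E] in
theorem uoConvergesTo_zero_of_disjoint {x : ℕ → E} (hx : IsDisjointFamily x) :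
    UoConvergesTo x 0 := by
  intro w hw
  simp only [sub_zero]
  exact orderConvergesTo_zero_of_disjoint (fun n => le_inf (abs_nonneg _) hw)
    (fun n => inf_le_right) fun m n hmn => inf_disjoint hw (hx m n hmn)

omit [IsOrderedModule ℝ E] in
theorem uawConvergesTo_zero_of_disjoint {x : ℕ → E} (hx : IsDisjointFamily x) :
    UawConvergesTo x 0 := by
  intro w hw φ
  simp only [sub_zero]
  obtain ⟨-, g, hg, -⟩ := exists_modulus φ.toLinearMap
    fun a _ => bddAbove_image_Icc_of_continuous φ a
  have h1 := tendsto_cofinite_of_disjoint (g := g.toLinearMap) (a := fun n => |x n| ⊓ w)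
    (fun _ => hg.nonneg) hw
    (fun n => le_inf (abs_nonneg _) hw) (fun n => inf_le_right)
    fun m n hmn => inf_disjoint hw (hx m n hmn)
  rw [Nat.cofinite_eq_atTop] at h1
  refine squeeze_zero_norm (fun n => ?_) h1
  have h2 := hg.abs_apply_le (|x n| ⊓ w)
  rw [abs_of_nonneg (le_inf (abs_nonneg _) hw)] at h2
  exact h2

omit [CompleteSpace E] [IsOrderedModule ℝ E] in
theorem unConvergesTo_zero_of_disjoint (hE : HasOrderContinuousNorm E) {x : ℕ → E}
    (hx : IsDisjointFamily x) : UnConvergesTo x 0 := by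
  intro w hw
  obtain ⟨B, i1, i2, i3, y, hy, hxy⟩ := uoConvergesTo_zero_of_disjoint hx w hw
  rw [Metric.tendsto_nhds]
  intro ε hε
  obtain ⟨b, hb⟩ := ((hE B y hy).eventually (gt_mem_nhds hε)).exists
  obtain ⟨n, hn⟩ := hxy b
  filter_upwards [eventually_ge_atTop n] with m hm
  have h1 := hn m hm
  rw [sub_zero] at h1
  rw [dist_zero_right, norm_norm]
  exact (norm_le_norm_of_abs_le_abs (h1.trans (le_abs_self _))).trans_lt hb

/-- If `f` is continuous along bounded disjoint sequences, then its modulus `g` controls `f`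
along bounded nets through the truncations of the net. -/
theorem tendsto_of_tendsto_modulus_truncations {f : E →ₗ[ℝ] ℝ} {g : StrongDual ℝ E}
    (hg : IsModulus f g.toLinearMap)
    (hgf : ∀ a, 0 ≤ a → ∀ ε, 0 < ε → ∃ w, |w| ≤ a ∧ g a < f w + ε)
    (hf : ∀ x : ℕ → E, IsNormBoundedFamily x → IsDisjointFamily x →
      Tendsto (fun n => f (x n)) atTop (𝓝 0))
    {A : Type v} {l : Filter A} {x : A → E} (hx : IsNormBoundedFamily x)
    (h : ∀ w, 0 ≤ w → Tendsto (fun a => g (|x a| ⊓ w)) l (𝓝 0)) :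
    Tendsto (fun a => f (x a)) l (𝓝 0) :=
  tendsto_of_tendsto_truncations hg.abs_apply_le
    (fun C _ hε => exists_forall_apply_posPart_sub_lt (fun _ => hg.nonneg)
      (tendsto_modulus_of_disjoint (g := g.toLinearMap) (fun _ => hg.nonneg) hgf hf) C hε) hx h

/-- For `x ≥ 0` with `‖x‖ ≤ 1`, disjoint functionals `φ n ∈ [0, g]` satisfy
`φ n x ≤ φ n w + g (x - w)⁺`, and `∑ φ n w ≤ g w`. -/
theorem disjointSeqBelowModulusNormNull_of_disjoint {f : E →ₗ[ℝ] ℝ} {g : StrongDual ℝ E}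
    (hg : IsModulus f g.toLinearMap)
    (hgf : ∀ a, 0 ≤ a → ∀ ε, 0 < ε → ∃ w, |w| ≤ a ∧ g a < f w + ε)
    (hf : ∀ x : ℕ → E, IsNormBoundedFamily x → IsDisjointFamily x →
      Tendsto (fun n => f (x n)) atTop (𝓝 0)) : DisjointSeqBelowModulusNormNull f := by
  refine ⟨g.toLinearMap, hg, fun φ hφ hd => ?_⟩
  have hsum : ∀ w, 0 ≤ w → Tendsto (fun n => φ n w) atTop (𝓝 0) := fun w hw => by
    have h1 : Summable fun n => φ n w := by
      refine summable_of_sum_le (c := g w) (fun n => (hφ n).1 w hw) fun s => ?_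
      have h2 := sum_le_of_areDisjointFunctionals (fun _ => hg.nonneg) hφ
        (fun m n hmn => .of_isGLB (hd m n hmn)) s w hw
      rw [LinearMap.sum_apply] at h2
      exact h2
    exact h1.tendsto_atTop_zero
  rw [Metric.tendsto_nhds]
  intro ε hε
  obtain ⟨w, hw, hwK⟩ := exists_forall_apply_posPart_sub_lt (g := g.toLinearMap)
    (fun _ => hg.nonneg) (tendsto_modulus_of_disjoint (fun _ => hg.nonneg) hgf hf) 1
    (show 0 < ε / 4 by positivity)
  filter_upwards [(hsum w hw).eventually (gt_mem_nhds (show 0 < ε / 4 by positivity))] with n hn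
  have hpos : ∀ a : E, 0 ≤ a → 0 ≤ φ n a := (hφ n).1
  have h1 : ‖φ n‖ ≤ ε / 2 := by
    refine ContinuousLinearMap.opNorm_le_of_unit_norm (by positivity) fun x hx => ?_
    have h2 : φ n |x| = φ n (|x| ⊓ w) + φ n (|x| - w)⁺ := by
      rw [← map_add, inf_add_posPart_sub]
    have h3 : φ n (|x| ⊓ w) ≤ φ n w :=
      LinearMap.mono_of_nonneg (g := (φ n).toLinearMap) hpos inf_le_right
    have h4 : φ n (|x| - w)⁺ ≤ g (|x| - w)⁺ := (hφ n).2 _ (posPart_nonneg _)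
    have h5 : g (|x| - w)⁺ < ε / 4 :=
      hwK |x| (abs_nonneg x) (by rw [norm_abs_eq_norm, hx])
    have h6 : |φ n x| ≤ φ n |x| := abs_le'.2
      ⟨LinearMap.mono_of_nonneg (g := (φ n).toLinearMap) hpos (le_abs_self x), by
        rw [← map_neg]
        exact LinearMap.mono_of_nonneg (g := (φ n).toLinearMap) hpos (neg_le_abs x)⟩
    rw [Real.norm_eq_abs]
    linarith
  rw [dist_zero_right, norm_norm]
  linarith

omit [IsOrderedModule ℝ E] in
/-- The components of `|f|` in the directions of disjoint elements `|x n|` are disjoint, and they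
agree with `|f|` at `|x n|`. -/
theorem tendsto_of_disjointSeqBelowModulusNormNull {f : E →ₗ[ℝ] ℝ}
    (h : DisjointSeqBelowModulusNormNull f) (x : ℕ → E) (hx : IsNormBoundedFamily x)
    (hd : IsDisjointFamily x) : Tendsto (fun n => f (x n)) atTop (𝓝 0) := by
  obtain ⟨g, hg, hnull⟩ := h
  have hg0 : 0 ≤ g := fun _ => hg.nonneg
  choose φ hφ using fun n => exists_component hg0 (abs_nonneg (x n))
  have hφ0 : ∀ n, 0 ≤ (φ n).toLinearMap := fun n a ha =>
    (hg0 _ (le_inf ha (nsmul_nonneg (abs_nonneg (x n)) 0))).trans ((hφ n a ha).1 ⟨0, rfl⟩)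
  have hφg : ∀ n, (φ n).toLinearMap ≤ g := fun n a ha => (hφ n a ha).2 <| by
    rintro _ ⟨k, rfl⟩
    exact LinearMap.mono_of_nonneg hg0 inf_le_left
  have hdis : ∀ m n, m ≠ n →
      AreDisjointFunctionals (φ m).toLinearMap (φ n).toLinearMap := by
    intro m n hmn a ha ε hε
    obtain ⟨_, ⟨k, rfl⟩, hk, -⟩ := (hφ m a ha).exists_between (sub_lt_self (φ m a) hε)
    -- `c` carries almost all of `φ m a`, while `φ n c = 0`
    set c := a ⊓ k • |x m| with hc
    have hc0 : 0 ≤ c := le_inf ha (nsmul_nonneg (abs_nonneg _) k)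
    have h1 : g c ≤ φ m c := (hφ m c hc0).1 ⟨k, by simp only [hc, inf_assoc, inf_idem]⟩
    have h2 : φ n c ≤ 0 := (hφ n c hc0).2 <| by
      rintro _ ⟨j, rfl⟩
      have h3 : (k • |x m|) ⊓ (j • |x n|) = 0 := by
        refine nsmul_inf_eq_zero (abs_nonneg _) (nsmul_nonneg (abs_nonneg _) j) ?_ k
        rw [inf_comm]
        exact nsmul_inf_eq_zero (abs_nonneg _) (abs_nonneg _) (hd n m hmn.symm) j
      have h4 : c ⊓ j • |x n| = 0 := inf_eq_zero_mono hc0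
        (nsmul_nonneg (abs_nonneg _) j) inf_le_right le_rfl h3
      simp only [h4, map_zero, le_refl]
    refine ⟨a - c, sub_nonneg.2 inf_le_left, sub_le_self _ hc0, ?_⟩
    rw [sub_sub_cancel, map_sub]
    simp only [ContinuousLinearMap.coe_coe]
    linarith
  have hlim := hnull φ (fun n => ⟨hφ0 n, hφg n⟩)
    fun m n hmn => (hdis m n hmn).isGLB (hφ0 m) (hφ0 n)
  obtain ⟨C, hC⟩ := hx
  have hlim2 : Tendsto (fun n => ‖φ n‖ * C) atTop (𝓝 0) := by simpa using hlim.mul_const C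
  refine squeeze_zero_norm (fun n => ?_) hlim2
  calc ‖f (x n)‖ ≤ g |x n| := hg.abs_apply_le (x n)
    _ ≤ φ n |x n| := (hφ n _ (abs_nonneg _)).1 ⟨1, by simp only [one_nsmul, inf_idem]⟩
    _ ≤ ‖φ n |x n|‖ := Real.le_norm_self _
    _ ≤ ‖φ n‖ * ‖|x n|‖ := (φ n).le_opNorm _
    _ ≤ ‖φ n‖ * C := by rw [norm_abs_eq_norm]; gcongr; exact hC n

end Equivalences

theorem mainTheorem5 {E : Type u} [NormedAddCommGroup E] [NormedSpace ℝ E] [CompleteSpace E]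
    [Lattice E] [IsOrderedAddMonoid E] [IsOrderedModule ℝ E] [HasSolidNorm E]
    (f : E →ₗ[ℝ] ℝ) (hf : IsOrderContinuousFunctional f) :
    List.TFAE [
      IsBoundedUoContinuous f,
      ∀ x : ℕ → E, IsNormBoundedFamily x → UoConvergesTo x 0 →
        Tendsto (fun n => f (x n)) atTop (𝓝 0),
      IsBoundedUawContinuous f,
      ∀ x : ℕ → E, IsNormBoundedFamily x → UawConvergesTo x 0 →
        Tendsto (fun n => f (x n)) atTop (𝓝 0),
      IsBoundedDContinuous f,
      ∀ x : ℕ → E, IsNormBoundedFamily x → IsDisjointFamily x →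
        Tendsto (fun n => f (x n)) atTop (𝓝 0),
      DisjointSeqBelowModulusNormNull f] ∧
    (HasOrderContinuousNorm E →
      List.TFAE [
        IsBoundedUoContinuous f,
        IsBoundedUnContinuous f,
        ∀ x : ℕ → E, IsNormBoundedFamily x → UnConvergesTo x 0 →
          Tendsto (fun n => f (x n)) atTop (𝓝 0)]) := by
  obtain ⟨hcont, g, hg, hgf⟩ := exists_modulus f hf.bddAbove
  have hdown : ∀ {x : ℕ → E}, IsNormBoundedFamily x →
      IsNormBoundedFamily fun n : ULift.{u} ℕ => x n.down := fun ⟨C, hC⟩ => ⟨C, fun n => hC _⟩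
  have hdownlim : Tendsto (ULift.down : ULift.{u} ℕ → ℕ) atTop atTop :=
    tendsto_atTop_atTop.2 fun b => ⟨⟨b⟩, fun _ ha => ha⟩
  have h61 : (∀ x : ℕ → E, IsNormBoundedFamily x → IsDisjointFamily x →
      Tendsto (fun n => f (x n)) atTop (𝓝 0)) → IsBoundedUoContinuous f := by
    intro h A _ _ _ x hx huo
    refine tendsto_of_tendsto_modulus_truncations hg hgf h hx fun w hw => ?_
    have h1 := huo w hw
    simp only [sub_zero] at h1
    exact hg.tendsto_of_orderConvergesTo hf (fun a => le_inf (abs_nonneg _) hw) h1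
  have h12 : IsBoundedUoContinuous f → ∀ x : ℕ → E, IsNormBoundedFamily x → UoConvergesTo x 0 →
      Tendsto (fun n => f (x n)) atTop (𝓝 0) := fun h x hx huo =>
    tendsto_of_tendsto_down (h (ULift.{u} ℕ) _ (hdown hx) fun w hw => (huo w hw).comp_down)
  have h26 : (∀ x : ℕ → E, IsNormBoundedFamily x → UoConvergesTo x 0 →
      Tendsto (fun n => f (x n)) atTop (𝓝 0)) → ∀ x : ℕ → E, IsNormBoundedFamily x →
      IsDisjointFamily x → Tendsto (fun n => f (x n)) atTop (𝓝 0) := fun h x hx hd =>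
    h x hx (uoConvergesTo_zero_of_disjoint hd)
  refine ⟨?_, fun hE => ?_⟩
  · tfae_have 1 → 2 := h12
    tfae_have 2 → 6 := h26
    tfae_have 6 → 1 := h61
    tfae_have 3 → 4 := fun h x hx huaw => tendsto_of_tendsto_down <|
      h.2 (ULift.{u} ℕ) _ (hdown hx) fun w hw φ => (huaw w hw φ).comp hdownlim
    tfae_have 4 → 6 := fun h x hx hd => h x hx (uawConvergesTo_zero_of_disjoint hd)
    tfae_have 6 → 3 := by
      refine fun h => ⟨hcont, fun A _ _ _ x hx huaw => ?_⟩
      refine tendsto_of_tendsto_modulus_truncations hg hgf h hx fun w hw => ?_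
      simpa only [sub_zero] using huaw w hw g
    have hmax : NoMaxOrder (ULift.{u} ℕ) := ⟨fun n => ⟨⟨n.down + 1⟩, Nat.lt_succ_self n.down⟩⟩
    tfae_have 5 → 6 := fun h x hx hd => tendsto_of_tendsto_down <|
      h.2 (ULift.{u} ℕ) _ (hdown hx) fun a b hab => hd _ _ fun hab' => hab (ULift.ext _ _ hab')
    tfae_have 6 → 5 := by
      refine fun h => ⟨hcont, fun A _ _ _ _ x hx hd => ?_⟩
      refine tendsto_of_tendsto_modulus_truncations hg hgf h hx fun w hw => ?_
      exact (tendsto_cofinite_of_disjoint (g := g.toLinearMap) (fun _ => hg.nonneg) hw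
        (fun a => le_inf (abs_nonneg _) hw) (fun a => inf_le_right)
        fun a b hab => inf_disjoint hw (hd a b hab)).mono_left atTop_le_cofinite
    tfae_have 6 → 7 := disjointSeqBelowModulusNormNull_of_disjoint hg hgf
    tfae_have 7 → 6 := tendsto_of_disjointSeqBelowModulusNormNull
    tfae_finish
  · tfae_have 1 → 2 := by
      refine fun h => ⟨hcont, fun A _ _ _ x hx hun => ?_⟩
      refine tendsto_of_tendsto_modulus_truncations hg hgf (h26 (h12 h)) hx fun w hw => ?_
      have h1 := hun w hw
      simp only [sub_zero] at h1
      have h2 := (g.continuous.tendsto 0).comp (tendsto_zero_iff_norm_tendsto_zero.2 h1)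
      rwa [map_zero] at h2
    tfae_have 2 → 3 := fun h x hx hun => tendsto_of_tendsto_down <|
      h.2 (ULift.{u} ℕ) _ (hdown hx) fun w hw => (hun w hw).comp hdownlim
    tfae_have 3 → 1 := fun h => h61 fun x hx hd =>
      h x hx (unConvergesTo_zero_of_disjoint hE hd)
    tfae_finish
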